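/- Let $(\Omega,\mathcal F,P)$ be a nonatomic probability space, i.e. one that supports a random variable with a continuous distribution. A map $\rho:L^\infty(P)\to\mathbb R$ is a *monetary risk measure* if $\rho(X)\ge\rho(Y)$ whenever $X\le Y$ $P$-a.s., and $\rho(X+m)=\rho(X)-m$ for all $m\in\mathbb R$. It is *positively homogeneous* if moreover $\rho(\alpha X)=\alpha\rho(X)$ for all $\alpha\ge 0$, and *law-invariant* if $\rho(X)=\rho(Y)$ whenever $X$ and $Y$ have the same distribution under $P$. For $X\in L^\infty(P)$ with distribution function $F_X$ put $q_X(t)=\inf\{x\in\mathbb R: F_X(x)>t\}$ for $t\in[0,1)$, $q_X(1)=\lim_{t\uparrow1}q_X(t)$, and $\mathrm{VaR}_t(X)=-q_X(t)$ for $t\in[0,1]$. Let $\mathscr M_{1,f}(\ell)$ be the set of all finitely additive probability measures on the Borel $\sigma$-algebra of $[0,1]$ that are absolutely continuous with respect to Lebesgue measure $\ell$ (i.e. vanish on $\ell$-null sets), with the weak* topology induced by $L^\infty([0,1],\ell)$. For a map $\rho:L^\infty(P)\to\mathbb R$ the following are equivalent: (a) $\rho$ is a law-invariant, positively homogeneous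 (monetary) risk measure. (b) There is a family $\{\mathscr M_\lambda\mid\lambda\in\Lambda\}$ of nonempty, weak*-compact, convex subsets of $\mathscr M_{1,f}(\ell)$ such that $$\rho(X)=\min_{\lambda\in\Lambda}\max_{\mu\in\mathscr M_\lambda}\int_0^1\mathrm{VaR}_t(X)\,\mu(dt)\qquad\text{for all }X\in L^\infty(P),$$ where all the maxima and the minimum are attained. -/

import Mathlib

open MeasureTheory ProbabilityTheory Filter Topology
open scoped ENNReal unitInterval

noncomputable section

namespace RiskMeasure

section RiskMeasures

variable {Ω : Type*} [MeasurableSpace Ω]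

/-- The probability space supports a random variable with a continuous distribution. -/
def IsNonatomic (P : Measure Ω) : Prop :=
  ∃ U : Ω → ℝ, Measurable U ∧ Continuous (cdf (P.map U))

/-- Monetary risk measures on `L^∞(P)`. -/
structure IsMonetary (P : Measure Ω) [IsProbabilityMeasure P] (ρ : Lp ℝ ∞ P → ℝ) : Prop where
  monotone : ∀ X Y : Lp ℝ ∞ P, X ≤ᵐ[P] Y → ρ Y ≤ ρ X
  translation : ∀ (X : Lp ℝ ∞ P) (m : ℝ), ρ (X + Lp.const ∞ P m) = ρ X - m

/-- Positively homogeneous risk measures on `L^∞(P)`. -/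
structure IsPositivelyHomogeneous (P : Measure Ω) [IsProbabilityMeasure P]
    (ρ : Lp ℝ ∞ P → ℝ) : Prop extends IsMonetary P ρ where
  pos_homogeneous : ∀ (X : Lp ℝ ∞ P) (a : ℝ), 0 ≤ a → ρ (a • X) = a * ρ X

/-- `ρ` takes the same value at random variables with the same distribution under `P`. -/
def IsLawInvariant (P : Measure Ω) (ρ : Lp ℝ ∞ P → ℝ) : Prop :=
  ∀ X Y : Lp ℝ ∞ P, IdentDistrib X Y P P → ρ X = ρ Y

/-- `inf {x | F_X(x) > t}`, meaningful for `t ∈ [0,1)`. -/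
def quantileAux (P : Measure Ω) (X : Lp ℝ ∞ P) (t : ℝ) : ℝ :=
  sInf {x : ℝ | t < cdf (P.map X) x}

/-- The upper quantile function `q_X` on `[0,1]`, with `q_X(1) = q_X(1-)`. -/
def quantile (P : Measure Ω) (X : Lp ℝ ∞ P) (t : I) : ℝ :=
  if (t : ℝ) < 1 then quantileAux P X t else limUnder (𝓝[<] (1 : ℝ)) (quantileAux P X)

/-- Value at risk, `VaR_t(X) = -q_X(t)`. -/
def VaR (P : Measure Ω) (X : Lp ℝ ∞ P) (t : I) : ℝ :=
  -quantile P X t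

end RiskMeasures

/-- Finitely additive probability measures on the `σ`-algebra of `α` which are absolutely
continuous with respect to `ν`, i.e. the set `M_{1,f}(ν)`. -/
structure FinAddProb {α : Type*} [MeasurableSpace α] (ν : Measure α) where
  /-- The value on each measurable set. -/
  toFun : {s : Set α // MeasurableSet s} → ℝ
  nonneg : ∀ s, 0 ≤ toFun s
  univ : toFun ⟨Set.univ, MeasurableSet.univ⟩ = 1
  union : ∀ s t : {s : Set α // MeasurableSet s}, Disjoint s.1 t.1 →
    toFun ⟨s.1 ∪ t.1, s.2.union t.2⟩ = toFun s + toFun t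
  absCont : ∀ s, ν s.1 = 0 → toFun s = 0

namespace FinAddProb

variable {α : Type*} [MeasurableSpace α] {ν : Measure α}

/-- The integral of a simple function, `∑ x, x μ(g = x)`. -/
def integralSimple (μ : FinAddProb ν) (g : SimpleFunc α ℝ) : ℝ :=
  ∑ x ∈ g.range, x * μ.toFun ⟨g ⁻¹' {x}, g.measurableSet_fiber x⟩

/-- The integral of an essentially bounded measurable function against a finitely additive
probability `μ ≪ ν`: the supremum of the integrals of the simple functions below it.
Inequalities are only required `ν`-a.e., since `μ` does not charge `ν`-null sets, so that the
integral is defined on classes in `L^∞(ν)` too. -/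
def integral (μ : FinAddProb ν) (f : α → ℝ) : ℝ :=
  sSup {r : ℝ | ∃ g : SimpleFunc α ℝ, g ≤ᵐ[ν] f ∧ r = μ.integralSimple g}

/-- The weak* topology: the coarsest one for which `μ ↦ ∫ f dμ` is continuous for every
`f ∈ L^∞(ν)`. -/
instance weakStarTopology : TopologicalSpace (FinAddProb ν) :=
  TopologicalSpace.induced (fun μ (f : Lp ℝ ∞ ν) => μ.integral f) Pi.topologicalSpace

/-- Convexity of a set of finitely additive probabilities, seen inside the vector space of all
real functions on the `σ`-algebra. -/
def IsConvex (S : Set (FinAddProb ν)) : Prop :=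
  Convex ℝ (FinAddProb.toFun '' S)

end FinAddProb

end RiskMeasure

end

noncomputable section

namespace RiskMeasure

namespace FinAddProb

/-! ### Integrals of simple functions against a finitely additive probability. -/

section Integral

variable {α : Type*} [MeasurableSpace α] {ν : Measure α}

/-! For (a) ⇒ (b), attach to each position `Z` the set `S Z` of all `μ` with `∫ VaR(Z) dμ ≤ ρ Z`.
The maximum of `∫ VaR(X) dμ` over `S X` is at most `ρ X` by definition, so everything rests on
finding in each `S Z` some `μ` with `∫ VaR(X) dμ ≥ ρ X`; this is `exists_separating_measure`.

Its proof takes place in the plane. The pairs `(∫ VaR(Z) dμ, ∫ VaR(X) dμ)` form a compact convex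
set, because the finitely additive probabilities are weak*-compact (`compactSpace`). If it missed
the quadrant `(-∞, ρ Z] × [ρ X, ∞)`, a separating line would give `a, b ≥ 0` with `-a VaR(Z) + b
VaR(X) ≤ u` a.e. (`ae_le_of_forall_integral_le`). Law invariance lets `Z` and `X` be replaced by
their quantile functions at one common uniform variable, which turns this into an almost sure
inequality; monotonicity, translation and homogeneity then give `-a ρ Z + b ρ X ≤ u`, against the
strict separation (`add_le_of_ae_VaR`).

For (b) ⇒ (a), each integral `∫ VaR(X) dμ` already has the required properties, and these pass
through maxima and minima. -/

theorem toFun_injective : Function.Injective (toFun : FinAddProb ν → _) := by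
  rintro ⟨f, _, _, _, _⟩ ⟨g, _, _, _, _⟩ h
  cases h
  rfl

theorem toFun_le_one (μ : FinAddProb ν) (s) : μ.toFun s ≤ 1 := by
  have h := μ.union s ⟨s.1ᶜ, s.2.compl⟩ disjoint_compl_right
  simp only [Set.union_compl_self, μ.univ] at h
  linarith [μ.nonneg ⟨s.1ᶜ, s.2.compl⟩]

theorem nonempty (μ : FinAddProb ν) : Nonempty α := by
  by_contra h
  rw [not_nonempty_iff] at h
  have h1 := μ.absCont ⟨Set.univ, MeasurableSet.univ⟩ (by simp [Set.univ_eq_empty_iff.2 h])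
  rw [μ.univ] at h1
  exact one_ne_zero h1

open scoped Classical in
/-- A finitely additive probability as an operator-valued set function. -/
def toOperator (μ : FinAddProb ν) (s : Set α) : ℝ →L[ℝ] ℝ :=
  if h : MeasurableSet s then μ.toFun ⟨s, h⟩ • ContinuousLinearMap.id ℝ ℝ else 0

theorem toOperator_apply (μ : FinAddProb ν) {s : Set α} (h : MeasurableSet s) (x : ℝ) :
    μ.toOperator s x = μ.toFun ⟨s, h⟩ * x := by
  simp [toOperator, h]

theorem finMeasAdditive_toOperator (μ : FinAddProb ν) : FinMeasAdditive ν μ.toOperator := by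
  intro s t hs ht _ _ hst
  ext
  simp [toOperator, hs, ht, hs.union ht, ← μ.union ⟨s, hs⟩ ⟨t, ht⟩ hst]

/-- `setToSimpleFunc` needs only finite additivity, so its calculus supplies linearity and
monotonicity. -/
theorem integralSimple_eq (μ : FinAddProb ν) (g : SimpleFunc α ℝ) :
    μ.integralSimple g = g.setToSimpleFunc μ.toOperator := by
  refine Finset.sum_congr rfl fun x _ => ?_
  rw [toOperator_apply μ (g.measurableSet_fiber x), mul_comm]

theorem integralSimple_const (μ : FinAddProb ν) (c : ℝ) :
    μ.integralSimple (SimpleFunc.const α c) = c := by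
  have := μ.nonempty
  have h := μ.univ
  simp only [integralSimple, SimpleFunc.range_const, Finset.sum_singleton, SimpleFunc.coe_const]
  have : (⟨Function.const α c ⁻¹' {c}, (SimpleFunc.const α c).measurableSet_fiber c⟩ :
      {s : Set α // MeasurableSet s}) = ⟨Set.univ, MeasurableSet.univ⟩ := by
    ext; simp
  erw [this]
  rw [h, mul_one]

variable [IsFiniteMeasure ν]

theorem integrable_simpleFunc (g : SimpleFunc α ℝ) : Integrable g ν :=
  g.integrable_of_isFiniteMeasure

theorem integralSimple_add (μ : FinAddProb ν) (g h : SimpleFunc α ℝ) :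
    μ.integralSimple (g + h) = μ.integralSimple g + μ.integralSimple h := by
  simp only [integralSimple_eq]
  exact SimpleFunc.setToSimpleFunc_add _ μ.finMeasAdditive_toOperator
    (integrable_simpleFunc g) (integrable_simpleFunc h)

theorem integralSimple_smul (μ : FinAddProb ν) (c : ℝ) (g : SimpleFunc α ℝ) :
    μ.integralSimple (c • g) = c * μ.integralSimple g := by
  simp only [integralSimple_eq]
  exact SimpleFunc.setToSimpleFunc_smul_real _ μ.finMeasAdditive_toOperator c
    (integrable_simpleFunc g)

theorem integralSimple_congr (μ : FinAddProb ν) {g h : SimpleFunc α ℝ} (hgh : g =ᵐ[ν] h) :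
    μ.integralSimple g = μ.integralSimple h := by
  simp only [integralSimple_eq]
  refine SimpleFunc.setToSimpleFunc_congr _ (fun s hs h0 => ?_) μ.finMeasAdditive_toOperator
    (integrable_simpleFunc g) hgh
  ext
  rw [toOperator_apply μ hs, μ.absCont ⟨s, hs⟩ h0]
  simp

theorem integralSimple_mono (μ : FinAddProb ν) {g h : SimpleFunc α ℝ} (hgh : g ≤ᵐ[ν] h) :
    μ.integralSimple g ≤ μ.integralSimple h := by
  -- The a.e. inequality becomes a pointwise one once `g` is replaced by `g ⊓ h`.
  have h1 : g =ᵐ[ν] (g ⊓ h : SimpleFunc α ℝ) := by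
    filter_upwards [hgh] with x hx
    simpa using hx
  rw [integralSimple_congr μ h1, integralSimple_eq, integralSimple_eq]
  refine SimpleFunc.setToSimpleFunc_mono μ.finMeasAdditive_toOperator (fun s hs _ x hx => ?_)
    (integrable_simpleFunc _) (integrable_simpleFunc _) inf_le_right
  rw [toOperator_apply μ hs]
  exact mul_nonneg (μ.nonneg _) hx

/-- Functions that are `ν`-essentially uniform limits of simple functions. -/
def IsApproximable (ν : Measure α) (f : α → ℝ) : Prop :=
  ∀ ε > 0, ∃ g : SimpleFunc α ℝ, ∀ᵐ x ∂ν, |f x - g x| ≤ ε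

end Integral

/-! ### Integrals of essentially bounded functions, and weak* compactness. -/

section ApproximableIntegral

variable {α : Type*} [MeasurableSpace α] {ν : Measure α}

theorem IsApproximable.congr {f f' : α → ℝ} (hf : IsApproximable ν f) (h : f =ᵐ[ν] f') :
    IsApproximable ν f' := by
  intro ε hε
  obtain ⟨g, hg⟩ := hf ε hε
  refine ⟨g, ?_⟩
  filter_upwards [hg, h] with x hx hx'
  rwa [← hx']

theorem IsApproximable.add {f f' : α → ℝ} (hf : IsApproximable ν f) (hf' : IsApproximable ν f') :
    IsApproximable ν (fun x => f x + f' x) := by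
  intro ε hε
  obtain ⟨g, hg⟩ := hf (ε / 2) (by positivity)
  obtain ⟨g', hg'⟩ := hf' (ε / 2) (by positivity)
  refine ⟨g + g', ?_⟩
  filter_upwards [hg, hg'] with x hx hx'
  rw [abs_le] at *
  simp only [SimpleFunc.coe_add, Pi.add_apply]
  constructor <;> linarith

theorem IsApproximable.const_mul {f : α → ℝ} (hf : IsApproximable ν f) (c : ℝ) :
    IsApproximable ν (fun x => c * f x) := by
  intro ε hε
  obtain ⟨g, hg⟩ := hf (ε / (|c| + 1)) (by positivity)
  refine ⟨c • g, ?_⟩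
  filter_upwards [hg] with x hx
  simp only [SimpleFunc.coe_smul, Pi.smul_apply, smul_eq_mul, ← mul_sub, abs_mul]
  calc |c| * |f x - g x| ≤ |c| * (ε / (|c| + 1)) := by gcongr
    _ ≤ (|c| + 1) * (ε / (|c| + 1)) := by gcongr; linarith
    _ = ε := by field_simp

theorem isApproximable_const (c : ℝ) : IsApproximable ν (fun _ => c) :=
  fun ε hε => ⟨SimpleFunc.const α c, by simp [hε.le]⟩

theorem isApproximable_of_measurable_of_bounded {f : α → ℝ} (hf : Measurable f) {C : ℝ}
    (hC : ∀ x, |f x| ≤ C) : IsApproximable ν f := by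
  intro ε hε
  -- Rounding down to multiples of `ε`; boundedness leaves finitely many values.
  refine ⟨⟨fun x => ε * (⌊f x / ε⌋ : ℝ), fun y => ?_, ?_⟩, ?_⟩
  · refine measurableSet_eq_fun ?_ measurable_const
    exact ((measurable_from_top (f := fun n : ℤ => (n : ℝ))).comp
      (hf.div_const ε).floor).const_mul ε
  · refine ((Set.finite_Icc (⌊-C / ε⌋) (⌊C / ε⌋)).image (fun n : ℤ => ε * (n : ℝ))).subset ?_
    rintro _ ⟨x, rfl⟩
    refine ⟨⌊f x / ε⌋, ⟨Int.floor_mono ?_, Int.floor_mono ?_⟩, rfl⟩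
    · have := (abs_le.1 (hC x)).1
      gcongr
    · have := (abs_le.1 (hC x)).2
      gcongr
  · refine Eventually.of_forall fun x => ?_
    have h1 := Int.floor_le (f x / ε)
    have h2 := Int.lt_floor_add_one (f x / ε)
    rw [le_div_iff₀ hε] at h1
    rw [div_lt_iff₀ hε] at h2
    change |f x - ε * (⌊f x / ε⌋ : ℝ)| ≤ ε
    rw [abs_le]
    constructor <;> linarith

theorem isApproximable_of_ae_bounded {f : α → ℝ} (hf : AEMeasurable f ν) {C : ℝ}
    (hC : ∀ᵐ x ∂ν, |f x| ≤ C) : IsApproximable ν f := by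
  refine IsApproximable.congr (f := fun x => max (-|C|) (min (hf.mk f x) |C|))
    (isApproximable_of_measurable_of_bounded
      (measurable_const.max (hf.measurable_mk.min measurable_const)) (C := |C|) fun x => ?_) ?_
  · rw [abs_le]
    exact ⟨le_max_left _ _, max_le (by linarith [abs_nonneg C]) (min_le_right _ _)⟩
  · filter_upwards [hC, hf.ae_eq_mk] with x hx hx'
    have h := abs_le.1 (hx.trans (le_abs_self C))
    rw [← hx', min_eq_left h.2, max_eq_right h.1]

theorem ae_abs_le_norm (f : Lp ℝ ∞ ν) : ∀ᵐ x ∂ν, |f x| ≤ ‖f‖ := by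
  filter_upwards [ae_le_lpNorm_exponent_top (Lp.memLp f)] with x hx
  rw [← toReal_eLpNorm (Lp.aestronglyMeasurable f)] at hx
  exact hx

theorem isApproximable_Lp (f : Lp ℝ ∞ ν) : IsApproximable ν f :=
  isApproximable_of_ae_bounded (Lp.aestronglyMeasurable f).aemeasurable (ae_abs_le_norm f)

theorem integral_congr (μ : FinAddProb ν) {f f' : α → ℝ} (h : f =ᵐ[ν] f') :
    μ.integral f = μ.integral f' := by
  unfold integral
  congr 1
  ext r
  refine exists_congr fun g => and_congr_left fun _ => ⟨fun hg => hg.trans h.le, fun hg =>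
    hg.trans h.symm.le⟩

/-- The convex combination of two finitely additive probabilities. -/
def mix (μ₁ μ₂ : FinAddProb ν) (a b : ℝ) (ha : 0 ≤ a) (hb : 0 ≤ b) (hab : a + b = 1) :
    FinAddProb ν where
  toFun := a • μ₁.toFun + b • μ₂.toFun
  nonneg s := add_nonneg (mul_nonneg ha (μ₁.nonneg s)) (mul_nonneg hb (μ₂.nonneg s))
  univ := by simp [μ₁.univ, μ₂.univ, hab]
  union s t hst := by
    simp only [Pi.add_apply, Pi.smul_apply, smul_eq_mul, μ₁.union s t hst, μ₂.union s t hst]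
    ring
  absCont s hs := by simp [μ₁.absCont s hs, μ₂.absCont s hs]

/-- A countably additive probability `κ ≪ ν`, seen as a finitely additive one. -/
def ofMeasure (κ : Measure α) [IsProbabilityMeasure κ] (h : κ ≪ ν) : FinAddProb ν where
  toFun s := κ.real s.1
  nonneg _ := measureReal_nonneg
  univ := by simp
  union _ t hst := measureReal_union hst t.2
  absCont _ hs := by simp [Measure.real, h hs]

theorem integralSimple_ofMeasure (κ : Measure α) [IsProbabilityMeasure κ] (h : κ ≪ ν)
    (g : SimpleFunc α ℝ) : (ofMeasure κ h).integralSimple g = ∫ x, g x ∂κ := by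
  rw [← SimpleFunc.integral_eq_integral _ (integrable_simpleFunc g), SimpleFunc.integral_eq]
  exact Finset.sum_congr rfl fun x _ => by rw [smul_eq_mul, mul_comm]; rfl

theorem continuous_integral {f : α → ℝ} (hf : AEMeasurable f ν) {C : ℝ}
    (hC : ∀ᵐ x ∂ν, |f x| ≤ C) : Continuous fun μ : FinAddProb ν => μ.integral f := by
  have hmem : MemLp f ∞ ν := memLp_top_of_bound hf.aestronglyMeasurable C hC
  have h : Continuous fun μ : FinAddProb ν => μ.integral (hmem.toLp f) :=
    (continuous_apply (hmem.toLp f)).comp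
      (continuous_induced_dom (f := fun (μ : FinAddProb ν) (f : Lp ℝ ∞ ν) => μ.integral f))
  simpa only [integral_congr _ hmem.coeFn_toLp] using h

variable [IsFiniteMeasure ν]

/-- In the supremum defining the integral, `g - ε` is a competitor and every competitor is at most
`g + ε`. This estimate reduces the rules for `integral` to simple functions. -/
theorem abs_integral_sub_integralSimple_le (μ : FinAddProb ν) {f : α → ℝ} {g : SimpleFunc α ℝ}
    {ε : ℝ} (h : ∀ᵐ x ∂ν, |f x - g x| ≤ ε) : |μ.integral f - μ.integralSimple g| ≤ ε := by
  have hub : ∀ r ∈ {r : ℝ | ∃ g : SimpleFunc α ℝ, g ≤ᵐ[ν] f ∧ r = μ.integralSimple g},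
      r ≤ μ.integralSimple g + ε := by
    rintro _ ⟨k, hk, rfl⟩
    rw [← integralSimple_const μ ε, ← integralSimple_add]
    refine integralSimple_mono μ ?_
    filter_upwards [hk, h] with x hx hx'
    have := (abs_le.1 hx').2
    simp only [SimpleFunc.coe_add, SimpleFunc.coe_const, Pi.add_apply, Function.const_apply]
    linarith
  have hmem : μ.integralSimple g + -ε ∈
      {r : ℝ | ∃ g : SimpleFunc α ℝ, g ≤ᵐ[ν] f ∧ r = μ.integralSimple g} := by
    refine ⟨g + SimpleFunc.const α (-ε), ?_, by rw [integralSimple_add, integralSimple_const]⟩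
    filter_upwards [h] with x hx'
    have := (abs_le.1 hx').1
    simp only [SimpleFunc.coe_add, SimpleFunc.coe_const, Pi.add_apply, Function.const_apply]
    linarith
  have h1 : μ.integral f ≤ μ.integralSimple g + ε := csSup_le ⟨_, hmem⟩ hub
  have h2 : μ.integralSimple g + -ε ≤ μ.integral f := le_csSup ⟨_, hub⟩ hmem
  rw [abs_le]
  constructor <;> linarith

theorem integral_const (μ : FinAddProb ν) (c : ℝ) : μ.integral (fun _ => c) = c := by
  have h := abs_integral_sub_integralSimple_le μ (f := fun _ => c) (g := SimpleFunc.const α c)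
    (ε := 0) (by simp)
  rw [integralSimple_const] at h
  exact sub_eq_zero.1 (abs_nonpos_iff.1 h)

theorem integral_add (μ : FinAddProb ν) {f f' : α → ℝ} (hf : IsApproximable ν f)
    (hf' : IsApproximable ν f') :
    μ.integral (fun x => f x + f' x) = μ.integral f + μ.integral f' := by
  refine eq_of_forall_dist_le fun ε hε => ?_
  obtain ⟨g, hg⟩ := hf (ε / 4) (by positivity)
  obtain ⟨g', hg'⟩ := hf' (ε / 4) (by positivity)
  have h := abs_integral_sub_integralSimple_le μ hg
  have h' := abs_integral_sub_integralSimple_le μ hg'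
  have h'' : |μ.integral (fun x => f x + f' x) - μ.integralSimple (g + g')| ≤ ε / 2 := by
    refine abs_integral_sub_integralSimple_le μ ?_
    filter_upwards [hg, hg'] with x hx hx'
    rw [abs_le] at *
    simp only [SimpleFunc.coe_add, Pi.add_apply]
    constructor <;> linarith
  rw [integralSimple_add] at h''
  rw [Real.dist_eq]
  rw [abs_le] at *
  constructor <;> linarith

theorem integral_const_mul (μ : FinAddProb ν) {f : α → ℝ} (hf : IsApproximable ν f) (c : ℝ) :
    μ.integral (fun x => c * f x) = c * μ.integral f := by
  refine eq_of_forall_dist_le fun ε hε => ?_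
  -- The `+ 1` covers `c = 0`.
  have hδ : 0 < ε / (2 * (|c| + 1)) := by positivity
  obtain ⟨g, hg⟩ := hf _ hδ
  have hc : |c| * (ε / (2 * (|c| + 1))) ≤ ε / 2 := by
    rw [← mul_div_assoc, div_le_div_iff₀ (by positivity) (by norm_num)]
    nlinarith [abs_nonneg c]
  have h : |c * μ.integral f - c * μ.integralSimple g| ≤ ε / 2 := by
    rw [← mul_sub, abs_mul]
    exact (mul_le_mul_of_nonneg_left (abs_integral_sub_integralSimple_le μ hg)
      (abs_nonneg c)).trans hc
  have h' : |μ.integral (fun x => c * f x) - μ.integralSimple (c • g)| ≤ ε / 2 := by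
    refine abs_integral_sub_integralSimple_le μ ?_
    filter_upwards [hg] with x hx
    simp only [SimpleFunc.coe_smul, Pi.smul_apply, smul_eq_mul, ← mul_sub, abs_mul]
    exact (mul_le_mul_of_nonneg_left hx (abs_nonneg c)).trans hc
  rw [integralSimple_smul] at h'
  rw [Real.dist_eq]
  rw [abs_le] at *
  constructor <;> linarith

theorem integral_mono (μ : FinAddProb ν) {f f' : α → ℝ} (hf : IsApproximable ν f)
    (hf' : IsApproximable ν f') (h : f ≤ᵐ[ν] f') : μ.integral f ≤ μ.integral f' := by
  refine le_of_forall_pos_le_add fun ε hε => ?_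
  obtain ⟨g, hg⟩ := hf (ε / 4) (by positivity)
  obtain ⟨g', hg'⟩ := hf' (ε / 4) (by positivity)
  have h1 := abs_integral_sub_integralSimple_le μ hg
  have h2 := abs_integral_sub_integralSimple_le μ hg'
  have h3 : μ.integralSimple g ≤ μ.integralSimple g' + ε / 2 := by
    rw [← integralSimple_const μ (ε / 2), ← integralSimple_add]
    refine integralSimple_mono μ ?_
    filter_upwards [hg, hg', h] with x hx hx' hxx
    rw [abs_le] at *
    simp only [SimpleFunc.coe_add, SimpleFunc.coe_const, Pi.add_apply, Function.const_apply]
    linarith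
  rw [abs_le] at *
  linarith

/-- The integral is affine in the measure. -/
theorem integral_convex_combination {μ₁ μ₂ μ : FinAddProb ν} {a b : ℝ} (ha : 0 ≤ a) (hb : 0 ≤ b)
    (hab : a + b = 1) (hμ : μ.toFun = a • μ₁.toFun + b • μ₂.toFun) {f : α → ℝ}
    (hf : IsApproximable ν f) : μ.integral f = a * μ₁.integral f + b * μ₂.integral f := by
  refine eq_of_forall_dist_le fun ε hε => ?_
  obtain ⟨g, hg⟩ := hf (ε / 2) (by positivity)
  have h := abs_integral_sub_integralSimple_le μ hg
  have h1 := abs_integral_sub_integralSimple_le μ₁ hg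
  have h2 := abs_integral_sub_integralSimple_le μ₂ hg
  have hs : μ.integralSimple g = a * μ₁.integralSimple g + b * μ₂.integralSimple g := by
    simp only [integralSimple, hμ, Finset.mul_sum, ← Finset.sum_add_distrib, Pi.add_apply,
      Pi.smul_apply, smul_eq_mul]
    exact Finset.sum_congr rfl fun x _ => by ring
  rw [Real.dist_eq]
  obtain rfl : b = 1 - a := by linarith
  rw [abs_le] at *
  constructor <;> nlinarith

/-- Conditioning `ν` on a non-null set where the bound fails by a margin yields a countably additive
test measure whose integral is too large. -/
theorem ae_le_of_forall_integral_le {f : α → ℝ} (hf : IsApproximable ν f) {u : ℝ}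
    (h : ∀ μ : FinAddProb ν, μ.integral f ≤ u) : ∀ᵐ x ∂ν, f x ≤ u := by
  have key : ∀ ε > 0, ∀ᵐ x ∂ν, f x ≤ u + 3 * ε := by
    intro ε hε
    obtain ⟨g, hg⟩ := hf ε hε
    have hgu : ∀ᵐ x ∂ν, g x ≤ u + 2 * ε := by
      by_contra hcon
      set A : Set α := {x | u + 2 * ε < g x} with hA
      have hAm : MeasurableSet A := measurableSet_lt measurable_const g.measurable
      have hA0 : ν A ≠ 0 := by
        rw [ae_iff] at hcon
        simpa only [not_le] using hcon
      have : IsProbabilityMeasure ν[|A] := cond_isProbabilityMeasure hA0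
      have hac : ν[|A] ≪ ν := cond_absolutelyContinuous
      have h1 := abs_integral_sub_integralSimple_le (ofMeasure ν[|A] hac) hg
      have h2 := h (ofMeasure ν[|A] hac)
      have h3 : u + 2 * ε ≤ (ofMeasure ν[|A] hac).integralSimple g := by
        rw [integralSimple_ofMeasure]
        calc u + 2 * ε = ∫ _, u + 2 * ε ∂ν[|A] := by simp
          _ ≤ ∫ x, g x ∂ν[|A] := by
            refine integral_mono_ae (integrable_const _) (integrable_simpleFunc g) ?_
            filter_upwards [ae_cond_mem hAm] with x hx using le_of_lt hx
      rw [abs_le] at h1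
      linarith
    filter_upwards [hg, hgu] with x hx hx'
    rw [abs_le] at hx
    linarith
  have h' : ∀ᵐ x ∂ν, ∀ n : ℕ, f x ≤ u + 3 * (1 / ((n : ℝ) + 1)) :=
    ae_all_iff.2 fun n => key _ (by positivity)
  filter_upwards [h'] with x hx
  refine le_of_forall_pos_le_add fun ε hε => ?_
  obtain ⟨n, hn⟩ := exists_nat_one_div_lt (show 0 < ε / 3 by positivity)
  linarith [hx n]

/-- The space of finitely additive probabilities is weak*-compact. -/
instance compactSpace : CompactSpace (FinAddProb ν) := by
  let S : Set ({s : Set α // MeasurableSet s} → ℝ) := Set.range (toFun : FinAddProb ν → _)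
  -- Each condition involves finitely many coordinates, so `S` is closed in a cube that is compact
  -- by Tychonoff.
  have hS : S = {φ | (∀ s, φ s ∈ Set.Icc (0 : ℝ) 1) ∧ φ ⟨Set.univ, MeasurableSet.univ⟩ = 1 ∧
      (∀ s t : {s : Set α // MeasurableSet s}, Disjoint s.1 t.1 →
        φ ⟨s.1 ∪ t.1, s.2.union t.2⟩ = φ s + φ t) ∧ ∀ s, ν s.1 = 0 → φ s = 0} := by
    ext φ
    constructor
    · rintro ⟨μ, rfl⟩
      exact ⟨fun s => ⟨μ.nonneg s, μ.toFun_le_one s⟩, μ.univ, μ.union, μ.absCont⟩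
    · rintro ⟨h1, h2, h3, h4⟩
      exact ⟨⟨φ, fun s => (h1 s).1, h2, h3, h4⟩, rfl⟩
  have hclosed : IsClosed S := by
    rw [hS]
    simp only [Set.ofPred_and, Set.ofPred_forall]
    refine IsClosed.inter (isClosed_iInter fun s => isClosed_Icc.preimage (continuous_apply s))
      (IsClosed.inter (isClosed_eq (continuous_apply _) continuous_const) (IsClosed.inter
      (isClosed_iInter fun s => isClosed_iInter fun t => isClosed_iInter fun _ =>
        isClosed_eq (continuous_apply _) ((continuous_apply s).add (continuous_apply t)))
      (isClosed_iInter fun s => isClosed_iInter fun _ =>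
        isClosed_eq (continuous_apply _) continuous_const)))
  have hcomp : IsCompact S := by
    refine (isCompact_univ_pi fun _ => isCompact_Icc (a := (0 : ℝ)) (b := 1)).of_isClosed_subset
      hclosed ?_
    rw [hS]
    exact fun φ hφ s _ => hφ.1 s
  have : CompactSpace S := isCompact_iff_compactSpace.1 hcomp
  let Φ : S → FinAddProb ν := fun φ => φ.2.choose
  have hΦ : ∀ φ : S, (Φ φ).toFun = φ.1 := fun φ => φ.2.choose_spec
  -- Setwise convergence suffices: an integral is a limit, uniform over `S`, of integrals of simple
  -- functions, which depend on finitely many coordinates.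
  have hcont : Continuous Φ := by
    refine continuous_induced_rng.2 (continuous_pi fun f => ?_)
    refine continuous_of_uniform_approx_of_continuous fun V hV => ?_
    obtain ⟨ε, hε, hεV⟩ := Metric.mem_uniformity_dist.1 hV
    obtain ⟨g, hg⟩ := isApproximable_Lp f (ε / 2) (by positivity)
    refine ⟨fun φ => (Φ φ).integralSimple g, ?_, fun φ => hεV ?_⟩
    · simp only [integralSimple, hΦ]
      exact continuous_finsetSum _ fun x _ => continuous_const.mul
        ((continuous_apply _).comp continuous_subtype_val)
    · rw [Real.dist_eq]
      exact (abs_integral_sub_integralSimple_le _ hg).trans_lt (by linarith)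
  have hsurj : Function.Surjective Φ := fun μ =>
    ⟨⟨μ.toFun, μ, rfl⟩, toFun_injective (hΦ _)⟩
  exact hsurj.compactSpace hcont

end ApproximableIntegral
end FinAddProb

/-! ### Quantile functions, value at risk and the quantile transform. -/

section Quantiles

variable {Ω : Type*} [MeasurableSpace Ω] {P : Measure Ω}

theorem aemeasurable_Lp (X : Lp ℝ ∞ P) : AEMeasurable X P :=
  (Lp.aestronglyMeasurable X).aemeasurable

theorem VaR_congr_of_identDistrib {X Y : Lp ℝ ∞ P} (h : IdentDistrib X Y P P) :
    VaR P X = VaR P Y := by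
  have hq : quantileAux P X = quantileAux P Y := by
    funext t
    rw [quantileAux, quantileAux, h.map_eq]
  funext t
  rw [VaR, VaR, quantile, quantile, hq]

theorem VaR_of_lt_one (X : Lp ℝ ∞ P) {t : I} (ht : (t : ℝ) < 1) :
    VaR P X t = -quantileAux P X t := by
  rw [VaR, quantile, if_pos ht]

theorem ae_lt_one : ∀ᵐ t : I, (t : ℝ) < 1 := by
  filter_upwards [Measure.ae_ne (volume : Measure I) 1] with t ht
  exact lt_of_le_of_ne t.2.2 fun h => ht (Subtype.ext h)

/-- A monotone bounded version of the quantile function. -/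
def monotoneQuantile (P : Measure Ω) (X : Lp ℝ ∞ P) (t : I) : ℝ :=
  if (t : ℝ) < 1 then quantileAux P X t else ‖X‖

/-- Only `t = 1` can differ, a null point, so the left limit defining `q_X(1)` never has to be
evaluated. -/
theorem VaR_ae_eq (X : Lp ℝ ∞ P) : VaR P X =ᵐ[volume] fun t => -monotoneQuantile P X t := by
  filter_upwards [ae_lt_one] with t ht
  rw [VaR_of_lt_one X ht, monotoneQuantile, if_pos ht]

variable [IsProbabilityMeasure P]

theorem cdf_map_eq {f : Ω → ℝ} (hf : AEMeasurable f P) (x : ℝ) :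
    cdf (P.map f) x = P.real {ω | f ω ≤ x} := by
  have := Measure.isProbabilityMeasure_map hf
  rw [cdf_eq_real, measureReal_def, Measure.map_apply_of_aemeasurable hf measurableSet_Iic]
  rfl

theorem cdf_map_of_lt_neg_norm (X : Lp ℝ ∞ P) {x : ℝ} (hx : x < -‖X‖) :
    cdf (P.map X) x = 0 := by
  have h : P {ω | X ω ≤ x} = 0 := by
    refine measure_mono_null (t := {ω | ¬ |X ω| ≤ ‖X‖}) (fun ω hω h => ?_)
      (ae_iff.1 (FinAddProb.ae_abs_le_norm X))
    have h1 : X ω ≤ x := hω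
    linarith [(abs_le.1 h).1]
  rw [cdf_map_eq (aemeasurable_Lp X), measureReal_def, h, ENNReal.toReal_zero]

theorem cdf_map_norm (X : Lp ℝ ∞ P) : cdf (P.map X) ‖X‖ = 1 := by
  have h : {ω | X ω ≤ ‖X‖} =ᵐ[P] Set.univ := by
    rw [ae_eq_univ]
    refine measure_mono_null (t := {ω | ¬ |X ω| ≤ ‖X‖}) (fun ω hω h => hω ?_)
      (ae_iff.1 (FinAddProb.ae_abs_le_norm X))
    exact (abs_le.1 h).2
  rw [cdf_map_eq (aemeasurable_Lp X), measureReal_congr h, probReal_univ]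

theorem neg_norm_mem_lowerBounds (X : Lp ℝ ∞ P) {t : ℝ} (h0 : 0 ≤ t) :
    -‖X‖ ∈ lowerBounds {x : ℝ | t < cdf (P.map X) x} := by
  intro x hx
  by_contra hlt
  have h : t < cdf (P.map X) x := hx
  rw [cdf_map_of_lt_neg_norm X (not_le.1 hlt)] at h
  linarith

theorem norm_mem (X : Lp ℝ ∞ P) {t : ℝ} (h1 : t < 1) :
    ‖X‖ ∈ {x : ℝ | t < cdf (P.map X) x} := by
  rwa [Set.mem_ofPred_eq, cdf_map_norm]

/-- With this, translation and positive scaling of `X` act on quantiles as order isomorphisms of the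
line, which preserve greatest lower bounds. -/
theorem isGLB_quantileAux (X : Lp ℝ ∞ P) {t : ℝ} (h0 : 0 ≤ t) (h1 : t < 1) :
    IsGLB {x : ℝ | t < cdf (P.map X) x} (quantileAux P X t) :=
  isGLB_csInf ⟨_, norm_mem X h1⟩ ⟨_, neg_norm_mem_lowerBounds X h0⟩

theorem abs_quantileAux_le (X : Lp ℝ ∞ P) {t : ℝ} (h0 : 0 ≤ t) (h1 : t < 1) :
    |quantileAux P X t| ≤ ‖X‖ :=
  abs_le.2 ⟨(isGLB_quantileAux X h0 h1).2 (neg_norm_mem_lowerBounds X h0),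
    (isGLB_quantileAux X h0 h1).1 (norm_mem X h1)⟩

theorem quantileAux_mono_level (X : Lp ℝ ∞ P) {s t : ℝ} (h0 : 0 ≤ s) (hst : s ≤ t) (h1 : t < 1) :
    quantileAux P X s ≤ quantileAux P X t :=
  (isGLB_quantileAux X (h0.trans hst) h1).mono (isGLB_quantileAux X h0 (hst.trans_lt h1))
    fun _ hx => hst.trans_lt hx

theorem quantileAux_mono {X Y : Lp ℝ ∞ P} (h : X ≤ᵐ[P] Y) {t : ℝ} (h0 : 0 ≤ t) (h1 : t < 1) :
    quantileAux P X t ≤ quantileAux P Y t := by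
  refine (isGLB_quantileAux Y h0 h1).mono (isGLB_quantileAux X h0 h1) fun x hx => ?_
  refine lt_of_lt_of_le (show t < cdf (P.map Y) x from hx) ?_
  rw [cdf_map_eq (aemeasurable_Lp X), cdf_map_eq (aemeasurable_Lp Y)]
  refine ENNReal.toReal_mono (measure_ne_top _ _) (measure_mono_ae ?_)
  filter_upwards [h] with ω hω hY using hω.trans hY

theorem quantileAux_add_const (X : Lp ℝ ∞ P) (m : ℝ) {t : ℝ} (h0 : 0 ≤ t) (h1 : t < 1) :
    quantileAux P (X + Lp.const ∞ P m) t = quantileAux P X t + m := by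
  refine (isGLB_quantileAux (X + Lp.const ∞ P m) h0 h1).unique ?_
  have h := (OrderIso.isGLB_image' (OrderIso.addRight m)).2 (isGLB_quantileAux X h0 h1)
  rw [OrderIso.addRight_apply] at h
  convert h using 1
  ext x
  have hF : cdf (P.map (X + Lp.const ∞ P m : Lp ℝ ∞ P)) x = cdf (P.map X) (x - m) := by
    rw [cdf_map_eq (aemeasurable_Lp X), cdf_map_eq (aemeasurable_Lp _)]
    refine measureReal_congr ?_
    filter_upwards [Lp.coeFn_add X (Lp.const ∞ P m), Lp.coeFn_const (p := ∞) (μ := P) m]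
      with ω h1 h2
    refine propext ?_
    change (X + Lp.const ∞ P m : Lp ℝ ∞ P) ω ≤ x ↔ X ω ≤ x - m
    rw [h1, Pi.add_apply, h2, Function.const_apply, le_sub_iff_add_le]
  simp only [Set.mem_ofPred_eq, hF, Set.mem_image, OrderIso.addRight_apply]
  exact ⟨fun h => ⟨x - m, h, by ring⟩, by rintro ⟨y, hy, rfl⟩; simpa using hy⟩

theorem quantileAux_smul (X : Lp ℝ ∞ P) {a : ℝ} (ha : 0 ≤ a) {t : ℝ} (h0 : 0 ≤ t) (h1 : t < 1) :
    quantileAux P (a • X) t = a * quantileAux P X t := by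
  -- Scaling by zero is not an order isomorphism; there the norm bound forces the quantile to
  -- vanish.
  rcases ha.eq_or_lt with rfl | ha
  · have h := abs_quantileAux_le ((0 : ℝ) • X) h0 h1
    have h' : ‖(0 : ℝ) • X‖ = 0 := by rw [zero_smul, norm_zero]
    rw [h'] at h
    rw [zero_mul, abs_nonpos_iff.1 h]
  refine (isGLB_quantileAux (a • X) h0 h1).unique ?_
  have h := (OrderIso.isGLB_image' (OrderIso.mulLeft₀ a ha)).2 (isGLB_quantileAux X h0 h1)
  rw [OrderIso.mulLeft₀_apply] at h
  convert h using 1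
  ext x
  have hF : cdf (P.map (a • X : Lp ℝ ∞ P)) x = cdf (P.map X) (x / a) := by
    rw [cdf_map_eq (aemeasurable_Lp X), cdf_map_eq (aemeasurable_Lp _)]
    refine measureReal_congr ?_
    filter_upwards [Lp.coeFn_smul a X] with ω h1
    refine propext ?_
    change (a • X : Lp ℝ ∞ P) ω ≤ x ↔ X ω ≤ x / a
    rw [h1, Pi.smul_apply, smul_eq_mul, le_div_iff₀ ha, mul_comm]
  simp only [Set.mem_ofPred_eq, hF, Set.mem_image, OrderIso.mulLeft₀_apply]
  exact ⟨fun h => ⟨x / a, h, by field_simp⟩,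
    by rintro ⟨y, hy, rfl⟩; rwa [mul_div_cancel_left₀ _ ha.ne']⟩

theorem monotone_monotoneQuantile (X : Lp ℝ ∞ P) : Monotone (monotoneQuantile P X) := by
  intro s t hst
  unfold monotoneQuantile
  have hst' : (s : ℝ) ≤ t := hst
  by_cases ht : (t : ℝ) < 1
  · rw [if_pos ht, if_pos (hst'.trans_lt ht)]
    exact quantileAux_mono_level X s.2.1 hst' ht
  · rw [if_neg ht]
    split_ifs with hs
    · exact (abs_le.1 (abs_quantileAux_le X s.2.1 hs)).2
    · exact le_rfl

theorem abs_monotoneQuantile_le (X : Lp ℝ ∞ P) (t : I) : |monotoneQuantile P X t| ≤ ‖X‖ := by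
  unfold monotoneQuantile
  split_ifs with h
  · exact abs_quantileAux_le X t.2.1 h
  · rw [abs_norm]

theorem aemeasurable_VaR (X : Lp ℝ ∞ P) : AEMeasurable (VaR P X) :=
  ((monotone_monotoneQuantile X).measurable.neg.aemeasurable).congr (VaR_ae_eq X).symm

theorem ae_abs_VaR_le (X : Lp ℝ ∞ P) : ∀ᵐ t, |VaR P X t| ≤ ‖X‖ := by
  filter_upwards [VaR_ae_eq X] with t ht
  rw [ht, abs_neg]
  exact abs_monotoneQuantile_le X t

theorem isApproximable_VaR (X : Lp ℝ ∞ P) : FinAddProb.IsApproximable volume (VaR P X) :=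
  FinAddProb.isApproximable_of_ae_bounded (aemeasurable_VaR X) (ae_abs_VaR_le X)

theorem integral_VaR_anti (μ : FinAddProb (volume : Measure I)) {X Y : Lp ℝ ∞ P}
    (h : X ≤ᵐ[P] Y) : μ.integral (VaR P Y) ≤ μ.integral (VaR P X) := by
  refine FinAddProb.integral_mono μ (isApproximable_VaR Y) (isApproximable_VaR X) ?_
  filter_upwards [ae_lt_one] with t ht
  rw [VaR_of_lt_one X ht, VaR_of_lt_one Y ht]
  exact neg_le_neg (quantileAux_mono h t.2.1 ht)

theorem integral_VaR_add_const (μ : FinAddProb (volume : Measure I)) (X : Lp ℝ ∞ P) (m : ℝ) :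
    μ.integral (VaR P (X + Lp.const ∞ P m)) = μ.integral (VaR P X) - m := by
  have h : VaR P (X + Lp.const ∞ P m) =ᵐ[volume] fun t => VaR P X t + -m := by
    filter_upwards [ae_lt_one] with t ht
    rw [VaR_of_lt_one _ ht, VaR_of_lt_one X ht, quantileAux_add_const X m t.2.1 ht]
    ring
  rw [FinAddProb.integral_congr μ h, FinAddProb.integral_add μ (isApproximable_VaR X)
    (FinAddProb.isApproximable_const _), FinAddProb.integral_const, sub_eq_add_neg]

theorem integral_VaR_smul (μ : FinAddProb (volume : Measure I)) (X : Lp ℝ ∞ P) {a : ℝ}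
    (ha : 0 ≤ a) : μ.integral (VaR P (a • X)) = a * μ.integral (VaR P X) := by
  have h : VaR P (a • X) =ᵐ[volume] fun t => a * VaR P X t := by
    filter_upwards [ae_lt_one] with t ht
    rw [VaR_of_lt_one _ ht, VaR_of_lt_one X ht, quantileAux_smul X ha t.2.1 ht]
    ring
  rw [FinAddProb.integral_congr μ h, FinAddProb.integral_const_mul μ (isApproximable_VaR X)]

theorem continuous_integral_VaR (X : Lp ℝ ∞ P) :
    Continuous fun μ : FinAddProb (volume : Measure I) => μ.integral (VaR P X) :=
  FinAddProb.continuous_integral (aemeasurable_VaR X) (ae_abs_VaR_le X)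

/-- A nonatomic probability space carries a uniformly distributed random variable. -/
theorem IsNonatomic.exists_uniform (hP : IsNonatomic P) :
    ∃ U : Ω → I, Measurable U ∧ P.map U = volume := by
  obtain ⟨V, hV, hF⟩ := hP
  have := Measure.isProbabilityMeasure_map (μ := P) hV.aemeasurable
  set F := cdf (P.map V) with hFdef
  have hFm : Measurable F := hF.measurable
  -- The probability integral transform.
  let U : Ω → I := fun ω => ⟨F (V ω), cdf_nonneg _ _, cdf_le_one _ _⟩
  have hU : Measurable U := (hFm.comp hV).subtype_mk
  refine ⟨U, hU, ?_⟩
  have := Measure.isProbabilityMeasure_map (μ := P) hU.aemeasurable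
  have hex : ∀ s : ℝ, 0 < s → s < 1 → ∃ x, F x = s := fun s h0 h1 => by
    obtain ⟨a, ha⟩ := ((tendsto_cdf_atBot (P.map V)).eventually (gt_mem_nhds h0)).exists
    obtain ⟨b, hb⟩ := ((tendsto_cdf_atTop (P.map V)).eventually (lt_mem_nhds h1)).exists
    exact mem_range_of_exists_le_of_exists_ge hF ⟨a, le_of_lt ha⟩ ⟨b, le_of_lt hb⟩
  -- The slack `t < s` is needed because `F` may have flat stretches: `F (V ω) < F x` forces `V ω ≤
  -- x`, whereas `F (V ω) ≤ F x` does not.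
  have hup : ∀ t : I, ∀ s : ℝ, (t : ℝ) < s → s < 1 → P.real {ω | U ω ≤ t} ≤ s := by
    intro t s hts hs1
    obtain ⟨x, hx⟩ := hex s (t.2.1.trans_lt hts) hs1
    rw [← hx, hFdef, cdf_map_eq hV.aemeasurable]
    refine measureReal_mono fun ω hω => ?_
    have h1 : F (V ω) ≤ t := hω
    by_contra hcon
    have h2 : F x ≤ F (V ω) := monotone_cdf _ (le_of_lt (not_le.1 hcon))
    linarith
  have hmain : ∀ t : I, P.real {ω | U ω ≤ t} = t := by
    intro t
    by_cases h1 : (t : ℝ) < 1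
    · refine le_antisymm (le_of_forall_gt_imp_ge_of_dense fun s hs => ?_) ?_
      · rcases lt_or_ge s 1 with hs1 | hs1
        · exact hup t s hs hs1
        · exact measureReal_le_one.trans hs1
      · rcases t.2.1.eq_or_lt with h0 | h0
        · rw [← h0]
          exact measureReal_nonneg
        · obtain ⟨x, hx⟩ := hex t h0 h1
          rw [← hx, hFdef, cdf_map_eq hV.aemeasurable]
          refine measureReal_mono fun ω hω => ?_
          change F (V ω) ≤ t
          rw [← hx]
          exact monotone_cdf _ hω
    · obtain rfl : t = 1 := Subtype.ext (le_antisymm t.2.2 (not_lt.1 h1))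
      have : {ω | U ω ≤ 1} = Set.univ := Set.eq_univ_of_forall fun ω => (U ω).2.2
      rw [this, probReal_univ]
      rfl
  refine Measure.ext_of_Iic _ _ fun t => ?_
  rw [unitInterval.volume_Iic, Measure.map_apply hU measurableSet_Iic, ← hmain t,
    measureReal_def, ENNReal.ofReal_toReal (measure_ne_top _ _)]
  rfl

/-- The exceptional levels are `t = 1` and `t = F_X(x)`. If `F_X(x) < t`, right continuity gives `y
> x` with `F_X(y) < t`, and then the quantile at `t` is at least `y`. -/
theorem monotoneQuantile_le_iff (X : Lp ℝ ∞ P) (x : ℝ) :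
    ∀ᵐ t : I, monotoneQuantile P X t ≤ x ↔ (t : ℝ) < cdf (P.map X) x := by
  filter_upwards [ae_lt_one,
    Measure.ae_ne (volume : Measure I) ⟨cdf (P.map X) x, cdf_nonneg _ _, cdf_le_one _ _⟩]
    with t ht hne
  have hglb := isGLB_quantileAux X t.2.1 ht
  rw [monotoneQuantile, if_pos ht]
  refine ⟨fun hle => ?_, fun h => hglb.1 h⟩
  by_contra hcon
  have hlt : cdf (P.map X) x < t :=
    lt_of_le_of_ne (not_lt.1 hcon) fun h => hne (Subtype.ext h.symm)
  have hev : ∀ᶠ y in 𝓝[>] x, cdf (P.map X) y < t :=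
    (((cdf (P.map X)).right_continuous x).mono Set.Ioi_subset_Ici_self).eventually
      (gt_mem_nhds hlt)
  obtain ⟨y, hy, hxy⟩ := (hev.and self_mem_nhdsWithin).exists
  have hyle : y ≤ quantileAux P X t := hglb.2 fun z hz => by
    by_contra hzy
    have h1 := monotone_cdf (P.map X) (le_of_lt (not_le.1 hzy))
    have h2 : (t : ℝ) < cdf (P.map X) z := hz
    linarith
  exact absurd (hyle.trans hle) (not_le.2 hxy)

theorem identDistrib_monotoneQuantile_comp (X : Lp ℝ ∞ P) {U : Ω → I} (hU : Measurable U)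
    (hUP : P.map U = volume) : IdentDistrib (monotoneQuantile P X ∘ U) X P P := by
  have hq := (monotone_monotoneQuantile X).measurable
  have hqU : AEMeasurable (monotoneQuantile P X ∘ U) P := (hq.comp hU).aemeasurable
  have := Measure.isProbabilityMeasure_map (aemeasurable_Lp X)
  have := Measure.isProbabilityMeasure_map hqU
  refine ⟨hqU, aemeasurable_Lp X, Measure.eq_of_cdf _ _ ?_⟩
  ext x
  have hset : P {ω | (monotoneQuantile P X ∘ U) ω ≤ x} =
      volume {t | monotoneQuantile P X t ≤ x} := by
    rw [← hUP, Measure.map_apply hU (measurableSet_le hq measurable_const)]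
    rfl
  have hset' : volume {t | monotoneQuantile P X t ≤ x} =
      volume (Set.Iio (⟨cdf (P.map X) x, cdf_nonneg _ _, cdf_le_one _ _⟩ : I)) := by
    refine measure_congr ?_
    filter_upwards [monotoneQuantile_le_iff X x] with t ht
    exact propext ht
  rw [cdf_map_eq hqU, measureReal_def, hset, hset', unitInterval.volume_Iio,
    ENNReal.toReal_ofReal (cdf_nonneg _ _)]

end Quantiles

/-! ### Planar separation, and transfer of properties through min-max. -/

section Representation

variable {Ω : Type*} [MeasurableSpace Ω] {P : Measure Ω} [IsProbabilityMeasure P]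

theorem FinAddProb.convex_image_integral_prod {α : Type*} [MeasurableSpace α] {ν : Measure α}
    [IsFiniteMeasure ν] {f g : α → ℝ} (hf : IsApproximable ν f) (hg : IsApproximable ν g) :
    Convex ℝ (Set.range fun μ : FinAddProb ν => (μ.integral f, μ.integral g)) := by
  rintro _ ⟨μ₁, rfl⟩ _ ⟨μ₂, rfl⟩ a b ha hb hab
  refine ⟨mix μ₁ μ₂ a b ha hb hab, ?_⟩
  simp [integral_convex_combination ha hb hab (μ := mix μ₁ μ₂ a b ha hb hab) rfl hf,
    integral_convex_combination ha hb hab (μ := mix μ₁ μ₂ a b ha hb hab) rfl hg]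

theorem FinAddProb.isConvex_setOf_integral_le {α : Type*} [MeasurableSpace α] {ν : Measure α}
    [IsFiniteMeasure ν] {f : α → ℝ} (hf : IsApproximable ν f) (c : ℝ) :
    IsConvex {μ : FinAddProb ν | μ.integral f ≤ c} := by
  rintro _ ⟨μ₁, h₁, rfl⟩ _ ⟨μ₂, h₂, rfl⟩ a b ha hb hab
  refine ⟨mix μ₁ μ₂ a b ha hb hab, ?_, rfl⟩
  have h₁' : μ₁.integral f ≤ c := h₁
  have h₂' : μ₂.integral f ≤ c := h₂
  rw [Set.mem_ofPred_eq,
    integral_convex_combination ha hb hab (μ := mix μ₁ μ₂ a b ha hb hab) rfl hf]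
  obtain rfl : b = 1 - a := by linarith
  nlinarith

/-- Comparing the scaled quantile functions of two random variables compares the values of a
law-invariant, positively homogeneous risk measure. -/
theorem IsPositivelyHomogeneous.add_le_of_ae_VaR {ρ : Lp ℝ ∞ P → ℝ}
    (hρ : IsPositivelyHomogeneous P ρ) (hlaw : IsLawInvariant P ρ) (hP : IsNonatomic P)
    (Z X : Lp ℝ ∞ P) {a b u : ℝ} (ha : 0 ≤ a) (hb : 0 ≤ b)
    (h : ∀ᵐ t : I, -a * VaR P Z t + b * VaR P X t ≤ u) : -a * ρ Z + b * ρ X ≤ u := by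
  obtain ⟨U, hU, hUP⟩ := hP.exists_uniform
  have hmem : ∀ Y : Lp ℝ ∞ P, MemLp (monotoneQuantile P Y ∘ U) ∞ P := fun Y =>
    memLp_top_of_bound
      ((monotone_monotoneQuantile Y).measurable.comp hU).aestronglyMeasurable ‖Y‖
      (Eventually.of_forall fun ω => abs_monotoneQuantile_le Y _)
  have hval : ∀ Y : Lp ℝ ∞ P, ρ ((hmem Y).toLp _) = ρ Y := fun Y => by
    refine hlaw _ _ (IdentDistrib.trans ?_ (identDistrib_monotoneQuantile_comp Y hU hUP))
    exact IdentDistrib.of_ae_eq (aemeasurable_Lp _) (hmem Y).coeFn_toLp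
  -- `Z'` and `X'` are copies of `Z` and `X` driven by the same uniform `U`, so a.e. inequalities
  -- between quantiles become almost sure ones.
  set Z' := (hmem Z).toLp _
  set X' := (hmem X).toLp _
  have hq : ∀ᵐ t : I, a * monotoneQuantile P Z t ≤ b * monotoneQuantile P X t + u := by
    filter_upwards [h, VaR_ae_eq Z, VaR_ae_eq X] with t ht hZ hX
    rw [hZ, hX] at ht
    linarith
  have hqU : ∀ᵐ ω ∂P,
      a * monotoneQuantile P Z (U ω) ≤ b * monotoneQuantile P X (U ω) + u := by
    rw [← hUP] at hq
    exact ae_of_ae_map hU.aemeasurable hq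
  have hle : (a • Z' : Lp ℝ ∞ P) ≤ᵐ[P] (b • X' + Lp.const ∞ P u : Lp ℝ ∞ P) := by
    filter_upwards [hqU, Lp.coeFn_smul a Z', Lp.coeFn_add (b • X') (Lp.const ∞ P u),
      Lp.coeFn_smul b X', Lp.coeFn_const (p := ∞) (μ := P) u, (hmem Z).coeFn_toLp,
      (hmem X).coeFn_toLp] with ω h0 h1 h2 h3 h4 h5 h6
    rw [h1, h2, Pi.add_apply, h3, h4, Pi.smul_apply, Pi.smul_apply, h5, h6]
    exact h0
  have h1 := hρ.monotone _ _ hle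
  rw [hρ.translation, hρ.pos_homogeneous _ _ ha, hρ.pos_homogeneous _ _ hb, hval, hval] at h1
  linarith

/-- Otherwise a line strictly separates the compact convex set of attainable integral pairs from a
closed quadrant, and `add_le_of_ae_VaR` contradicts this at the corner `(ρ Z, ρ X)`. -/
theorem IsPositivelyHomogeneous.exists_separating_measure {ρ : Lp ℝ ∞ P → ℝ}
    (hρ : IsPositivelyHomogeneous P ρ) (hlaw : IsLawInvariant P ρ) (hP : IsNonatomic P)
    (Z X : Lp ℝ ∞ P) : ∃ μ : FinAddProb (volume : Measure I),
      μ.integral (VaR P Z) ≤ ρ Z ∧ ρ X ≤ μ.integral (VaR P X) := by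
  by_contra! hcon
  obtain ⟨φ, u, v, hK, huv, hQ⟩ := geometric_hahn_banach_compact_closed
    (FinAddProb.convex_image_integral_prod (isApproximable_VaR Z) (isApproximable_VaR X))
    (isCompact_range ((continuous_integral_VaR Z).prodMk (continuous_integral_VaR X)))
    ((convex_Iic (𝕜 := ℝ) (ρ Z)).prod (convex_Ici (𝕜 := ℝ) (ρ X)))
    (isClosed_Iic.prod isClosed_Ici) (Set.disjoint_left.2 (by
      rintro _ ⟨μ, rfl⟩ ⟨h1, h2⟩
      exact absurd (hcon μ h1) (not_lt.2 h2)))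
  have hφ : ∀ p q : ℝ, φ (p, q) = p * φ (1, 0) + q * φ (0, 1) := fun p q => by
    have : ((p, q) : ℝ × ℝ) = p • (1, 0) + q • (0, 1) := by simp
    rw [this, map_add, map_smul, map_smul, smul_eq_mul, smul_eq_mul]
  have hQ' : ∀ s t : ℝ, 0 ≤ s → 0 ≤ t →
      v < (ρ Z - s) * φ (1, 0) + (ρ X + t) * φ (0, 1) := fun s t hs ht => by
    rw [← hφ]
    refine hQ _ ⟨?_, ?_⟩
    · exact sub_le_self _ hs
    · exact le_add_of_nonneg_right ht
  have h0 := hQ' 0 0 le_rfl le_rfl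
  -- The quadrant is unbounded while `φ > v` on it. With the wrong sign, the displacement chosen
  -- below makes `φ` exactly `v`; likewise for the other coefficient.
  have ha : φ (1, 0) ≤ 0 := by
    by_contra hpos
    rw [not_le] at hpos
    have := hQ' ((ρ Z * φ (1, 0) + ρ X * φ (0, 1) - v) / φ (1, 0)) 0
      (div_nonneg (by linarith) hpos.le) le_rfl
    rw [sub_mul, div_mul_cancel₀ _ hpos.ne'] at this
    linarith
  have hb : 0 ≤ φ (0, 1) := by
    by_contra hneg
    rw [not_le] at hneg
    have := hQ' 0 ((ρ Z * φ (1, 0) + ρ X * φ (0, 1) - v) / (-φ (0, 1))) le_rfl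
      (div_nonneg (by linarith) (by linarith))
    rw [add_mul, div_neg, neg_mul, div_mul_cancel₀ _ hneg.ne] at this
    linarith
  have hae := FinAddProb.ae_le_of_forall_integral_le
    (((isApproximable_VaR Z).const_mul (φ (1, 0))).add
      ((isApproximable_VaR X).const_mul (φ (0, 1)))) (u := u) fun μ => by
    rw [FinAddProb.integral_add μ ((isApproximable_VaR Z).const_mul _)
      ((isApproximable_VaR X).const_mul _),
      FinAddProb.integral_const_mul μ (isApproximable_VaR Z),
      FinAddProb.integral_const_mul μ (isApproximable_VaR X)]
    have := hK _ ⟨μ, rfl⟩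
    rw [hφ] at this
    linarith
  have hfinal := hρ.add_le_of_ae_VaR hlaw hP Z X (a := -φ (1, 0)) (u := u)
    (by linarith) hb (by simpa using hae)
  linarith

/-- Transport of a min-max representation along a monotone transformation of the integrals. -/
theorem eq_of_forall_integral_eq {α : Type*} [MeasurableSpace α] {ν : Measure α} {Λ : Type*}
    {M : Λ → Set (FinAddProb ν)} {f g : α → ℝ} {m m' : Λ → ℝ} {r r' : ℝ} {φ : ℝ → ℝ}
    (hφ : Monotone φ) (h : ∀ μ : FinAddProb ν, μ.integral g = φ (μ.integral f))
    (hm : ∀ l, IsGreatest ((fun μ => μ.integral f) '' M l) (m l))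
    (hm' : ∀ l, IsGreatest ((fun μ => μ.integral g) '' M l) (m' l))
    (hr : IsLeast (Set.range m) r) (hr' : IsLeast (Set.range m') r') : r' = φ r := by
  have hmm : m' = φ ∘ m := by
    funext l
    refine (hm' l).unique ?_
    have := hφ.map_isGreatest (hm l)
    rw [Set.image_image] at this
    simp only [h]
    exact this
  rw [hmm, Set.range_comp] at hr'
  exact hr'.unique (hφ.map_isLeast hr)

end Representation
end RiskMeasure

end

/-! ### The equivalence. -/

open RiskMeasure in
theorem mainTheorem5 {Ω : Type*} [MeasurableSpace Ω] (P : Measure Ω) [IsProbabilityMeasure P]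
    (hP : RiskMeasure.IsNonatomic P) (ρ : Lp ℝ ∞ P → ℝ) :
    (RiskMeasure.IsPositivelyHomogeneous P ρ ∧ RiskMeasure.IsLawInvariant P ρ) ↔
      ∃ (Λ : Type*) (M : Λ → Set (RiskMeasure.FinAddProb (volume : Measure unitInterval))),
        (∀ l, (M l).Nonempty ∧ IsCompact (M l) ∧ RiskMeasure.FinAddProb.IsConvex (M l)) ∧
        ∀ X : Lp ℝ ∞ P, ∃ m : Λ → ℝ,
          (∀ l, IsGreatest ((fun μ => μ.integral (RiskMeasure.VaR P X)) '' M l) (m l)) ∧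
          IsLeast (Set.range m) (ρ X) := by
  constructor
  · rintro ⟨hρ, hlaw⟩
    let S : Lp ℝ ∞ P → Set (FinAddProb (volume : Measure unitInterval)) := fun Z =>
      {μ | μ.integral (VaR P Z) ≤ ρ Z}
    have hne : ∀ Z, (S Z).Nonempty := fun Z =>
      let ⟨μ, hμ, _⟩ := hρ.exists_separating_measure hlaw hP Z Z
      ⟨μ, hμ⟩
    have hcomp : ∀ Z, IsCompact (S Z) := fun Z =>
      (isClosed_le (continuous_integral_VaR Z) continuous_const).isCompact
    -- Indexing by the sets themselves rather than by `Z` makes the index type independent of the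
    -- universe of `Ω`, so it lifts to any universe.
    refine ⟨ULift (Set.range S), fun l => l.down.1, ?_, fun X => ?_⟩
    · rintro ⟨_, Z, rfl⟩
      exact ⟨hne Z, hcomp Z, FinAddProb.isConvex_setOf_integral_le (isApproximable_VaR Z) _⟩
    · have hmax : ∀ l : ULift (Set.range S),
          ∃ r, IsGreatest ((fun μ => μ.integral (VaR P X)) '' l.down.1) r := by
        rintro ⟨_, Z, rfl⟩
        exact ((hcomp Z).image (continuous_integral_VaR X)).exists_isGreatest ((hne Z).image _)
      choose m hm using hmax
      have hlow : ∀ l, ρ X ≤ m l := by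
        rintro ⟨_, Z, rfl⟩
        obtain ⟨μ, hμZ, hμX⟩ := hρ.exists_separating_measure hlaw hP Z X
        exact hμX.trans ((hm ⟨_, Z, rfl⟩).2 ⟨μ, hμZ, rfl⟩)
      -- The minimum is attained at the index `S X`.
      refine ⟨m, hm, ⟨⟨⟨_, X, rfl⟩, le_antisymm ?_ (hlow _)⟩, ?_⟩⟩
      · obtain ⟨μ, hμ, hμm⟩ := (hm ⟨_, X, rfl⟩).1
        exact hμm.symm.le.trans hμ
      · rintro _ ⟨l, rfl⟩
        exact hlow l
  · rintro ⟨Λ, M, -, hrep⟩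
    choose m hm hρ using hrep
    refine ⟨⟨⟨fun X Y hXY => ?_, fun X c => ?_⟩, fun X a ha => ?_⟩, fun X Y hXY => ?_⟩
    -- An index minimal for the smaller position `X` serves as a competitor for `Y`.
    · obtain ⟨l, hl⟩ := (hρ X).1
      obtain ⟨μ, hμ, hμl⟩ := (hm Y l).1
      calc ρ Y ≤ m Y l := (hρ Y).2 ⟨l, rfl⟩
        _ = μ.integral (VaR P Y) := hμl.symm
        _ ≤ μ.integral (VaR P X) := integral_VaR_anti μ hXY
        _ ≤ m X l := (hm X l).2 ⟨μ, hμ, rfl⟩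
        _ = ρ X := hl
    · exact eq_of_forall_integral_eq (φ := fun r => r - c)
        (fun _ _ h => sub_le_sub_right h c) (fun μ => integral_VaR_add_const μ X c)
        (hm X) (hm _) (hρ X) (hρ _)
    · exact eq_of_forall_integral_eq (φ := fun r => a * r)
        (fun _ _ h => mul_le_mul_of_nonneg_left h ha) (fun μ => integral_VaR_smul μ X ha)
        (hm X) (hm _) (hρ X) (hρ _)
    · exact eq_of_forall_integral_eq (φ := id) monotone_id
        (fun μ => by rw [VaR_congr_of_identDistrib hXY, id])
        (hm Y) (hm X) (hρ Y) (hρ X)
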